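/- \textbf{Theorem (Sharp bounds).} Let $F_1,F_2$ be arbitrary distribution functions on $\mathbb{R}$, let $d\ge 1$ be an integer, and let $G_2$ be the distribution function of $X_2^d$ when $X_2\sim F_2$. Write $F^{-1}(p)=\inf\{x:F(x)\ge p\}$. Let $U,V$ be independent random variables, uniform on $[0,1]$, on a probability space on which all random variables below are defined. Put $$M=\mathbb{E}\big(F_1^{-1}(U)\,G_2^{-1}(U)\big),\qquad m=\mathbb{E}\big(F_1^{-1}(1-U)\,G_2^{-1}(U)\big).$$ If the expectation $M$ (respectively $m$) exists and is finite, then the positive (respectively negative) part of $X_1X_2^d$ is integrable whenever $X_1\sim F_1$, $X_2\sim F_2$, and $M$ is the supremum (respectively $m$ is the infimum) of $\mathbb{E}(X_1X_2^d)$ over all pairs with $X_1\sim F_1$, $X_2\sim F_2$ and $X_1X_2^d$ integrable; the supremum (respectively infimum) is attained. It is attained by $X_i=F_i^{-1}(U_i)$, $i=1,2$, with $U_1,U_2$ uniform on $[0,1]$, where $U_1=U$ for $M$ and $U_1=1-U$ for $m$, and $U_2$ is as follows. If $d$ is odd, $U_2=U$. If $d$ is even, let $\underline{x}_2=\inf\{x:F_2(x)>0\}\in[-\infty,\infty)$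 and $\bar{x}_2=\sup\{x:F_2(x)<1\}\in(-\infty,\infty]$, with $F_2(-\infty)=0$, $F_2(+\infty)=1$. Let $g(x)=x-F_2(-F_2^{-1}(x))$ for $x\in(0,1)$ (this is strictly increasing), $f=-g$, let $g^{-1},f^{-1}$ be their inverse functions, and let $$J=\mathbf{1}_{\{V>p(U)\}},\qquad p(u)=\frac{|g'(g^{-1}(u))|}{|f'(f^{-1}(u))|+|g'(g^{-1}(u))|}.$$ (1) Let $\underline{x}_2\le 0<\bar{x}_2$, $|\underline{x}_2|\le\bar{x}_2$ and $c=F_2(-\underline{x}_2)$. Then $U_2=(1-I)\big[J\,g^{-1}(U)+(1-J)\,f^{-1}(U)\big]+I\,U$ with $I=\mathbf{1}_{\{U>c\}}$. (2) Let $\underline{x}_2<0\le\bar{x}_2$, $|\underline{x}_2|\ge\bar{x}_2$ and $c=1-F_2(-\bar{x}_2)$. Then $U_2=(1-K)\big[J\,g^{-1}(U)+(1-J)\,f^{-1}(U)\big]+K\,(1-U)$ with $K=\mathbf{1}_{\{U>c\}}$. In (1) and (2) it is understood that the functions in the formula exist, that is, for almost every $u\in(0,c)$, $u$ belongs to the ranges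 of $g$ and $f$, $g$ is differentiable at $g^{-1}(u)$, and $f$ is differentiable at $f^{-1}(u)$. -/

import Mathlib

open MeasureTheory ProbabilityTheory Set

namespace SharpBounds

noncomputable section

/-- The uniform law on `[0,1]`. -/
def unif : Measure ℝ := volume.restrict (Icc (0 : ℝ) 1)

/-- The generalized quantile function `F⁻¹(p) = inf {x : F(x) ≥ p}`, where `F` is the CDF of `μ`.
It is only used for `p` in `(0,1)`, up to null sets. -/
def quantile (μ : Measure ℝ) (p : ℝ) : ℝ := sInf {x : ℝ | p ≤ cdf μ x}

/-- The law of `X ^ d` when `X` has law `μ`. -/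
def powLaw (μ : Measure ℝ) (d : ℕ) : Measure ℝ := μ.map (fun x : ℝ => x ^ d)

/-- The left endpoint of the domain of the CDF of `μ`, possibly `-∞`. -/
def lowerEnd (μ : Measure ℝ) : EReal := sInf ((fun x : ℝ => (x : EReal)) '' {x : ℝ | 0 < cdf μ x})

/-- The right endpoint of the domain of the CDF of `μ`, possibly `+∞`. -/
def upperEnd (μ : Measure ℝ) : EReal := sSup ((fun x : ℝ => (x : EReal)) '' {x : ℝ | cdf μ x < 1})

/-- The CDF of `μ` extended to `[-∞, +∞]`, so that `F(-∞) = 0` and `F(+∞) = 1`. -/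
def cdfExt (μ : Measure ℝ) (x : EReal) : ℝ := μ.real {y : ℝ | (y : EReal) ≤ x}

/-- `g(x) = x - F(-F⁻¹(x))`. -/
def g (μ : Measure ℝ) (x : ℝ) : ℝ := x - cdf μ (-quantile μ x)

/-- `f(x) = -g(x)`. -/
def f (μ : Measure ℝ) (x : ℝ) : ℝ := -g μ x

/-- The inverse function of `g` on `(0,1)`, where `g` is strictly increasing. -/
def gInv (μ : Measure ℝ) (u : ℝ) : ℝ := Function.invFunOn (g μ) (Ioo 0 1) u

/-- The inverse function of `f` on `(0,1)`, where `f` is strictly decreasing. -/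
def fInv (μ : Measure ℝ) (u : ℝ) : ℝ := Function.invFunOn (f μ) (Ioo 0 1) u

/-- The threshold `|g'| / (|f'| + |g'|)`, each derivative being taken on its own branch, that is,
`g'` at `g⁻¹(u)` and `f'` at `f⁻¹(u)`. -/
def threshold (μ : Measure ℝ) (u : ℝ) : ℝ :=
  |deriv (g μ) (gInv μ u)| / (|deriv (f μ) (fInv μ u)| + |deriv (g μ) (gInv μ u)|)

/-- The indicator `J` of `V > |g'| / (|f'| + |g'|)`. -/
def J (μ : Measure ℝ) (u v : ℝ) : ℝ := if threshold μ u < v then 1 else 0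

/-- The level `F(-x̲)` at which the indicator `I` switches. -/
def levelI (μ : Measure ℝ) : ℝ := cdfExt μ (-lowerEnd μ)

/-- The level `1 - F(-x̄)` at which the indicator `K` switches. -/
def levelK (μ : Measure ℝ) : ℝ := 1 - cdfExt μ (-upperEnd μ)

/-- The indicator `I` of `U > F(-x̲)`. -/
def I (μ : Measure ℝ) (u : ℝ) : ℝ := if levelI μ < u then 1 else 0

/-- The indicator `K` of `U > 1 - F(-x̄)`. -/
def K (μ : Measure ℝ) (u : ℝ) : ℝ := if levelK μ < u then 1 else 0

/-- `U₂` for even `d` when `|x̲| ≤ x̄`. -/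
def evenCaseI (μ : Measure ℝ) (u v : ℝ) : ℝ :=
  (1 - I μ u) * (J μ u v * gInv μ u + (1 - J μ u v) * fInv μ u) + I μ u * u

/-- `U₂` for even `d` when `|x̲| ≥ x̄`. -/
def evenCaseK (μ : Measure ℝ) (u v : ℝ) : ℝ :=
  (1 - K μ u) * (J μ u v * gInv μ u + (1 - J μ u v) * fInv μ u) + K μ u * (1 - u)

/-- The objects used below the level `c` exist: for almost every `u` in `(0,c)`, the inverse
functions of `g` and `f` are defined at `u`, and `g`, `f` are differentiable there. -/
def InverseBranches (μ : Measure ℝ) (c : ℝ) : Prop :=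
  ∀ᵐ u ∂(volume.restrict (Ioo (0 : ℝ) c)),
    (u ∈ g μ '' Ioo 0 1 ∧ DifferentiableAt ℝ (g μ) (gInv μ u)) ∧
    (u ∈ f μ '' Ioo 0 1 ∧ DifferentiableAt ℝ (f μ) (fInv μ u))

variable {Ω : Type*} [MeasurableSpace Ω]

/-- All finite values `E(X₁ X₂ ^ d)` with `X₁ ∼ μ₁` and `X₂ ∼ μ₂` on the given space. -/
def mixedMoments (P : Measure Ω) (μ₁ μ₂ : Measure ℝ) (d : ℕ) : Set ℝ :=
  {e : ℝ | ∃ X₁ X₂ : Ω → ℝ, HasLaw X₁ μ₁ P ∧ HasLaw X₂ μ₂ P ∧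
    Integrable (fun ω => X₁ ω * X₂ ω ^ d) P ∧ e = ∫ ω, X₁ ω * X₂ ω ^ d ∂P}

/-- The value `e` of `E(X₁ X₂ ^ d)` is obtained when `Xᵢ = Fᵢ⁻¹(Uᵢ)`: both `Uᵢ` are uniform, the
`Xᵢ` have the prescribed laws, and `E(X₁ X₂ ^ d)` is finite and equal to `e`. -/
structure Attains (P : Measure Ω) (μ₁ μ₂ : Measure ℝ) (d : ℕ) (U₁ U₂ : Ω → ℝ) (e : ℝ) : Prop where
  unif₁ : HasLaw U₁ unif P
  unif₂ : HasLaw U₂ unif P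
  law₁ : HasLaw (fun ω => quantile μ₁ (U₁ ω)) μ₁ P
  law₂ : HasLaw (fun ω => quantile μ₂ (U₂ ω)) μ₂ P
  integrable : Integrable (fun ω => quantile μ₁ (U₁ ω) * quantile μ₂ (U₂ ω) ^ d) P
  eq : ∫ ω, quantile μ₁ (U₁ ω) * quantile μ₂ (U₂ ω) ^ d ∂P = e

end

end SharpBounds

open SharpBounds

/-!
The comonotone pair is extremal: by the layer cake formula `E(XY)` is an integral over `s, t` of the
probabilities `P(X > s, Y > t)` and `P(X < -s, Y < -t)` minus those of mixed sign, and among all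
pairs with given marginals a comonotone pair maximizes the former and minimizes the latter
(Fréchet–Hoeffding). The lower bound follows on replacing `X₁` by `-X₁`.

A variable of law `G` that is comonotone with a uniform variable `U` equals `G⁻¹(U)` almost surely:
it dominates `G⁻¹(U)` and has the same law. Hence a uniform `U₂` attains the bounds as soon as
`F₂⁻¹(U₂) ^ d` is comonotone with `U`; for odd `d` this holds for `U₂ = U`. For even `d` let
`a = g⁻¹(u)` and `b = g⁻¹(-u) = f⁻¹(u)`. The Galois connection between `F₂` and `F₂⁻¹` gives
`a - b = u` and shows that `F₂⁻¹(a)` and `-F₂⁻¹(b)` increase with `u`, without overlap for distinct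
`u`, so that either choice of `U₂` makes `|F₂⁻¹(U₂)|` monotone in `u`. Differentiating `a - b = u`,
`1 / g'(a) + 1 / g'(b) = 1`, and choosing `a` and `b` with these two probabilities is precisely what
the change of variables formula requires for `U₂` to be uniform.
-/

namespace SharpBounds

section Comonotone

variable {Ω Ω' : Type*} [MeasurableSpace Ω] [MeasurableSpace Ω'] {P : Measure Ω} {Q : Measure Ω'}
  {X Y : Ω → ℝ} {A B : Ω' → ℝ}

theorem lintegral_ofReal_eq_lintegral_measure_lt (hX : AEMeasurable X P) :
    ∫⁻ ω, ENNReal.ofReal (X ω) ∂P = ∫⁻ s in Ioi (0 : ℝ), P {ω | s < X ω} := by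
  have h := lintegral_eq_lintegral_meas_lt P (f := fun ω => max (X ω) 0)
    (ae_of_all _ fun _ => le_max_right _ _) (hX.max aemeasurable_const)
  simp only [ENNReal.ofReal_max, ENNReal.ofReal_zero, zero_le, max_eq_left] at h
  refine h.trans (setLIntegral_congr_fun measurableSet_Ioi fun s hs => ?_)
  simp only [lt_max_iff, (mem_Ioi.1 hs).le.not_gt, or_false]

theorem lintegral_ofReal_mul_ofReal [SFinite P] (hX : AEMeasurable X P) (hY : AEMeasurable Y P) :
    ∫⁻ ω, ENNReal.ofReal (X ω) * ENNReal.ofReal (Y ω) ∂P =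
      ∫⁻ s in Ioi (0 : ℝ), ∫⁻ t in Ioi (0 : ℝ), P {ω | s < X ω ∧ t < Y ω} := by
  have hX' := hX.mono_ac (withDensity_absolutelyContinuous P fun ω => ENNReal.ofReal (Y ω))
  calc ∫⁻ ω, ENNReal.ofReal (X ω) * ENNReal.ofReal (Y ω) ∂P
      = ∫⁻ ω, ENNReal.ofReal (X ω) ∂P.withDensity fun ω => ENNReal.ofReal (Y ω) := by
        rw [lintegral_withDensity_eq_lintegral_mul₀ hY.ennreal_ofReal hX.ennreal_ofReal]
        simp only [Pi.mul_apply, mul_comm]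
    _ = ∫⁻ s in Ioi (0 : ℝ), ∫⁻ ω in {ω | s < X ω}, ENNReal.ofReal (Y ω) ∂P := by
        simp_rw [lintegral_ofReal_eq_lintegral_measure_lt hX', withDensity_apply' _ {ω | _ < X ω}]
    _ = _ := by
        refine lintegral_congr fun s => ?_
        rw [lintegral_ofReal_eq_lintegral_measure_lt hY.restrict]
        refine lintegral_congr fun t => ?_
        rw [Measure.restrict_apply₀' (nullMeasurableSet_lt aemeasurable_const hX)]
        exact congrArg P (ext fun ω => and_comm)

theorem ofReal_mul_eq_add (x y : ℝ) : ENNReal.ofReal (x * y) =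
    ENNReal.ofReal x * ENNReal.ofReal y + ENNReal.ofReal (-x) * ENNReal.ofReal (-y) := by
  rcases le_total 0 x with hx | hx
  · simp [ENNReal.ofReal_mul hx, ENNReal.ofReal_of_nonpos (neg_nonpos.2 hx)]
  · rw [← neg_mul_neg, ENNReal.ofReal_mul (neg_nonneg.2 hx), ENNReal.ofReal_of_nonpos hx,
      zero_mul, zero_add]

theorem lintegral_ofReal_mul [SFinite P] (hX : AEMeasurable X P) (hY : AEMeasurable Y P) :
    ∫⁻ ω, ENNReal.ofReal (X ω * Y ω) ∂P =
      (∫⁻ s in Ioi (0 : ℝ), ∫⁻ t in Ioi (0 : ℝ), P {ω | s < X ω ∧ t < Y ω}) +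
        ∫⁻ s in Ioi (0 : ℝ), ∫⁻ t in Ioi (0 : ℝ), P {ω | s < -X ω ∧ t < -Y ω} := by
  simp_rw [ofReal_mul_eq_add]
  rw [lintegral_add_left' (by fun_prop), lintegral_ofReal_mul_ofReal hX hY]
  exact congrArg _ (lintegral_ofReal_mul_ofReal hX.neg hY.neg)

/-- Two random variables are comonotone if almost surely they are ordered in the same way. The
almost sure event is part of the definition, so that the notion only depends on the variables up to
almost sure equality. -/
def Comonotone (P : Measure Ω) (X Y : Ω → ℝ) : Prop :=
  ∃ E ∈ ae P, MonovaryOn X Y E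

theorem Comonotone.neg (h : Comonotone P X Y) :
    Comonotone P (fun ω => -X ω) (fun ω => -Y ω) := by
  obtain ⟨E, hE, h⟩ := h
  exact ⟨E, hE, fun i hi j hj hij => neg_le_neg (h hj hi (neg_lt_neg_iff.1 hij))⟩

theorem Comonotone.measure_lt_and_lt (h : Comonotone P X Y) (s t : ℝ) :
    P {ω | s < X ω ∧ t < Y ω} = min (P {ω | s < X ω}) (P {ω | t < Y ω}) := by
  obtain ⟨E, hE, h⟩ := h
  refine le_antisymm (le_min (measure_mono fun _ => And.left) (measure_mono fun _ => And.right)) ?_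
  by_cases hsub : ∀ ω ∈ E, s < X ω → t < Y ω
  · refine (min_le_left _ _).trans (measure_mono_ae ?_)
    filter_upwards [hE] with ω hω hs using ⟨hs, hsub ω hω hs⟩
  · push Not at hsub
    obtain ⟨ω₀, hω₀, hs₀, ht₀⟩ := hsub
    refine (min_le_right _ _).trans (measure_mono_ae ?_)
    filter_upwards [hE] with ω hω ht using ⟨hs₀.trans_le (h hω₀ hω (ht₀.trans_lt ht)), ht⟩

theorem measure_add_measure_sub_one_le [IsProbabilityMeasure P] {S T : Set Ω}
    (hT : NullMeasurableSet T P) : P S + P T - 1 ≤ P (S ∩ T) := by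
  rw [tsub_le_iff_left, ← measure_union_add_inter₀ S hT]
  gcongr
  exact prob_le_one

theorem Comonotone.measure_lt_and_lt_neg [IsProbabilityMeasure P] (h : Comonotone P X Y)
    (hY : AEMeasurable Y P) (s t : ℝ) :
    P {ω | s < X ω ∧ t < -Y ω} = P {ω | s < X ω} + P {ω | t < -Y ω} - 1 := by
  obtain ⟨E, hE, h⟩ := h
  have hT : NullMeasurableSet {ω | t < -Y ω} P := nullMeasurableSet_lt aemeasurable_const hY.neg
  refine le_antisymm ?_ (measure_add_measure_sub_one_le hT)
  by_cases hdisj : ∀ ω ∈ E, ¬ (s < X ω ∧ t < -Y ω)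
  · exact (measure_mono_null (fun ω hω hωE => hdisj ω hωE hω) (mem_ae_iff.1 hE)).trans_le zero_le
  · push Not at hdisj
    obtain ⟨ω₀, hω₀, hs₀, ht₀⟩ := hdisj
    have hcover : 1 ≤ P ({ω | s < X ω} ∪ {ω | t < -Y ω}) := by
      rw [← measure_univ (μ := P)]
      refine measure_mono_ae ?_
      filter_upwards [hE] with ω hω _
      refine (lt_or_ge s (X ω)).imp_right fun hs => show t < -Y ω from ?_
      by_contra! ht
      exact (hs.trans_lt hs₀).not_ge (h hω₀ hω (by linarith))
    refine ENNReal.le_sub_of_add_le_left ENNReal.one_ne_top ?_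
    rw [← measure_union_add_inter₀ {ω | s < X ω} hT]
    exact add_le_add hcover le_rfl

theorem measure_lt_congr (hX : IdentDistrib X A P Q) (s : ℝ) :
    P {ω | s < X ω} = Q {ω | s < A ω} :=
  hX.measure_mem_eq measurableSet_Ioi

theorem Comonotone.measure_lt_and_lt_le (h : Comonotone Q A B) (hX : IdentDistrib X A P Q)
    (hY : IdentDistrib Y B P Q) (s t : ℝ) :
    P {ω | s < X ω ∧ t < Y ω} ≤ Q {ω | s < A ω ∧ t < B ω} := by
  rw [h.measure_lt_and_lt, ← measure_lt_congr hX, ← measure_lt_congr hY]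
  exact le_min (measure_mono fun _ => And.left) (measure_mono fun _ => And.right)

theorem Comonotone.lintegral_ofReal_mul_le [SFinite P] [SFinite Q] (h : Comonotone Q A B)
    (hX : IdentDistrib X A P Q) (hY : IdentDistrib Y B P Q) :
    ∫⁻ ω, ENNReal.ofReal (X ω * Y ω) ∂P ≤ ∫⁻ ω, ENNReal.ofReal (A ω * B ω) ∂Q := by
  rw [lintegral_ofReal_mul hX.aemeasurable_fst hY.aemeasurable_fst,
    lintegral_ofReal_mul hX.aemeasurable_snd hY.aemeasurable_snd]
  gcongr with s t s t
  · exact h.measure_lt_and_lt_le hX hY s t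
  · exact h.neg.measure_lt_and_lt_le (hX.comp measurable_neg) (hY.comp measurable_neg) s t

theorem Comonotone.integrable_posPart_mul [SFinite P] [SFinite Q] (h : Comonotone Q A B)
    (hX : IdentDistrib X A P Q) (hY : IdentDistrib Y B P Q)
    (hAB : Integrable (fun ω => A ω * B ω) Q) :
    Integrable (fun ω => max (X ω * Y ω) 0) P := by
  refine ⟨((hX.aemeasurable_fst.mul hY.aemeasurable_fst).max
    aemeasurable_const).aestronglyMeasurable, ?_⟩
  rw [hasFiniteIntegral_iff_ofReal (ae_of_all _ fun ω => le_max_right (X ω * Y ω) 0)]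
  simp only [ENNReal.ofReal_max, ENNReal.ofReal_zero, zero_le, max_eq_left]
  exact (h.lintegral_ofReal_mul_le hX hY).trans_lt hAB.lintegral_lt_top

variable [IsProbabilityMeasure P] [IsProbabilityMeasure Q]

theorem Comonotone.measure_lt_and_lt_neg_le (h : Comonotone Q A B) (hX : IdentDistrib X A P Q)
    (hY : IdentDistrib Y B P Q) (s t : ℝ) :
    Q {ω | s < A ω ∧ t < -B ω} ≤ P {ω | s < X ω ∧ t < -Y ω} := by
  have hY' : IdentDistrib (fun ω => -Y ω) (fun ω => -B ω) P Q := hY.comp measurable_neg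
  rw [h.measure_lt_and_lt_neg hY.aemeasurable_snd, ← measure_lt_congr hX, ← measure_lt_congr hY']
  exact measure_add_measure_sub_one_le
    (nullMeasurableSet_lt aemeasurable_const hY.aemeasurable_fst.neg)

theorem Comonotone.lintegral_ofReal_neg_mul_le (h : Comonotone Q A B) (hX : IdentDistrib X A P Q)
    (hY : IdentDistrib Y B P Q) :
    ∫⁻ ω, ENNReal.ofReal (-(A ω * B ω)) ∂Q ≤ ∫⁻ ω, ENNReal.ofReal (-(X ω * Y ω)) ∂P := by
  have hY' : IdentDistrib (fun ω => -Y ω) (fun ω => -B ω) P Q := hY.comp measurable_neg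
  simp_rw [← mul_neg]
  rw [lintegral_ofReal_mul hX.aemeasurable_fst hY'.aemeasurable_fst,
    lintegral_ofReal_mul hX.aemeasurable_snd hY'.aemeasurable_snd]
  gcongr with s t s t
  · exact h.measure_lt_and_lt_neg_le hX hY s t
  · exact h.neg.measure_lt_and_lt_neg_le (hX.comp measurable_neg) (hY.comp measurable_neg) s t

theorem Comonotone.integral_mul_le (h : Comonotone Q A B) (hX : IdentDistrib X A P Q)
    (hY : IdentDistrib Y B P Q) (hAB : Integrable (fun ω => A ω * B ω) Q)
    (hXY : Integrable (fun ω => X ω * Y ω) P) :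
    ∫ ω, X ω * Y ω ∂P ≤ ∫ ω, A ω * B ω ∂Q := by
  rw [integral_eq_lintegral_pos_part_sub_lintegral_neg_part hXY,
    integral_eq_lintegral_pos_part_sub_lintegral_neg_part hAB]
  exact sub_le_sub
    (ENNReal.toReal_mono hAB.lintegral_lt_top.ne (h.lintegral_ofReal_mul_le hX hY))
    (ENNReal.toReal_mono hXY.neg.lintegral_lt_top.ne (h.lintegral_ofReal_neg_mul_le hX hY))

end Comonotone

section Quantile

open Filter Topology

variable {Ω : Type*} [MeasurableSpace Ω] {P : Measure Ω} {U X Y : Ω → ℝ} {p : ℝ}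

theorem quantile_le_iff (μ : Measure ℝ) (hp : p ∈ Ioo (0 : ℝ) 1) (x : ℝ) :
    quantile μ p ≤ x ↔ p ≤ cdf μ x := by
  have hne : {x : ℝ | p ≤ cdf μ x}.Nonempty :=
    ((tendsto_cdf_atTop μ).eventually (eventually_ge_nhds hp.2)).exists
  have hbdd : BddBelow {x : ℝ | p ≤ cdf μ x} := by
    obtain ⟨a, ha⟩ := ((tendsto_cdf_atBot μ).eventually (eventually_lt_nhds hp.1)).exists
    exact ⟨a, fun y hy => ((monotone_cdf μ).reflect_lt (ha.trans_le hy)).le⟩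
  refine ⟨fun h => ?_, csInf_le hbdd⟩
  have hright : Tendsto (cdf μ) (𝓝[>] quantile μ p) (𝓝 (cdf μ (quantile μ p))) :=
    ((cdf μ).right_continuous _).mono Ioi_subset_Ici_self
  refine (ge_of_tendsto hright ?_).trans (monotone_cdf μ h)
  filter_upwards [self_mem_nhdsWithin] with y hy
  obtain ⟨z, hz, hzy⟩ := exists_lt_of_csInf_lt hne hy
  exact le_trans hz (monotone_cdf μ hzy.le)

theorem lt_quantile_iff (μ : Measure ℝ) (hp : p ∈ Ioo (0 : ℝ) 1) (x : ℝ) :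
    x < quantile μ p ↔ cdf μ x < p := by
  rw [← not_le, quantile_le_iff μ hp, not_le]

theorem le_cdf_quantile (μ : Measure ℝ) (hp : p ∈ Ioo (0 : ℝ) 1) : p ≤ cdf μ (quantile μ p) :=
  (quantile_le_iff μ hp _).1 le_rfl

theorem monotoneOn_quantile (μ : Measure ℝ) : MonotoneOn (quantile μ) (Ioo 0 1) :=
  fun _ hp _ hq hpq => (quantile_le_iff μ hp _).2 (hpq.trans (le_cdf_quantile μ hq))

theorem unif_eq_restrict_Ioo : unif = volume.restrict (Ioo (0 : ℝ) 1) :=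
  (Measure.restrict_congr_set Ioo_ae_eq_Icc).symm

instance isProbabilityMeasure_unif : IsProbabilityMeasure unif := ⟨by simp [unif]⟩

instance nullSingletonClass_unif : NullSingletonClass unif :=
  inferInstanceAs (NullSingletonClass (volume.restrict _))

theorem ae_mem_Ioo_of_hasLaw (hU : HasLaw U unif P) : ∀ᵐ ω ∂P, U ω ∈ Ioo (0 : ℝ) 1 := by
  refine ae_of_ae_map hU.aemeasurable ?_
  rw [hU.map_eq, unif_eq_restrict_Ioo]
  exact ae_restrict_mem measurableSet_Ioo

theorem unif_Iic (hp : p ≤ 1) : unif (Iic p) = ENNReal.ofReal p := by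
  have hinter : Iic p ∩ Icc 0 1 = Icc 0 p := by
    ext x
    exact ⟨fun h => ⟨h.2.1, h.1⟩, fun h => ⟨h.2, h.1, h.2.trans hp⟩⟩
  rw [unif, Measure.restrict_apply measurableSet_Iic, hinter, Real.volume_Icc, sub_zero]

theorem hasLaw_quantile (μ : Measure ℝ) [IsProbabilityMeasure μ] :
    HasLaw (quantile μ) μ unif := by
  have hmeas : AEMeasurable (quantile μ) unif := by
    rw [unif_eq_restrict_Ioo]
    exact aemeasurable_restrict_of_monotoneOn measurableSet_Ioo (monotoneOn_quantile μ)
  refine ⟨hmeas, ?_⟩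
  have := Measure.isProbabilityMeasure_map hmeas
  refine Measure.ext_of_Iic _ _ fun x => ?_
  have hpre : quantile μ ⁻¹' Iic x =ᵐ[unif] Iic (cdf μ x) := by
    filter_upwards [ae_mem_Ioo_of_hasLaw HasLaw.id] with p hp
    exact propext (quantile_le_iff μ hp x)
  rw [Measure.map_apply_of_aemeasurable hmeas measurableSet_Iic, measure_congr hpre,
    unif_Iic (cdf_le_one μ x), ofReal_cdf]

theorem hasLaw_one_sub : HasLaw (fun u : ℝ => 1 - u) unif unif := by
  have h := (Measure.measurePreserving_sub_left volume (1 : ℝ)).restrict_preimage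
    (s := Icc (0 : ℝ) 1) measurableSet_Icc
  rw [preimage_const_sub_Icc, sub_self, sub_zero] at h
  exact h.hasLaw

theorem ae_eq_of_ae_le_of_identDistrib [IsFiniteMeasure P] (hle : X ≤ᵐ[P] Y)
    (h : IdentDistrib X Y P P) : X =ᵐ[P] Y := by
  -- `arctan` is bounded, so that expectations can be compared without assuming integrability.
  have hint {Z : Ω → ℝ} (hZ : AEMeasurable Z P) :
      Integrable (fun ω => Real.arctan (Z ω)) P :=
    .of_bound (Real.measurable_arctan.comp_aemeasurable hZ).aestronglyMeasurable (Real.pi / 2)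
      (ae_of_all _ fun ω => (abs_lt.2 ⟨Real.neg_pi_div_two_lt_arctan _,
        Real.arctan_lt_pi_div_two _⟩).le)
  have harctan := (integral_eq_iff_of_ae_le (hint h.aemeasurable_fst) (hint h.aemeasurable_snd)
    (hle.mono fun _ hω => Real.arctan_strictMono.monotone hω)).1
    (h.comp Real.measurable_arctan).integral_eq
  exact harctan.mono fun _ hω => Real.arctan_injective hω

theorem Comonotone.le_cdf (h : Comonotone P Y U) (hU : HasLaw U unif P) {ν : Measure ℝ}
    [IsProbabilityMeasure ν] (hY : HasLaw Y ν P) : ∀ᵐ ω ∂P, U ω ≤ cdf ν (Y ω) := by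
  obtain ⟨E, hE, h⟩ := h
  filter_upwards [hE, ae_mem_Ioo_of_hasLaw hU] with ω hω hUω
  rw [← ENNReal.ofReal_le_ofReal_iff (cdf_nonneg ν _)]
  calc ENNReal.ofReal (U ω)
      = unif (Iic (U ω)) := (unif_Iic hUω.2.le).symm
    _ = unif (Iio (U ω)) := measure_congr Iio_ae_eq_Iic.symm
    _ = P {ω' | U ω' < U ω} := (hU.measure_eq measurableSet_Iio).symm
    _ ≤ P {ω' | Y ω' ≤ Y ω} :=
        measure_mono_ae (by filter_upwards [hE] with ω' hω' hlt using h hω' hω hlt)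
    _ = ν (Iic (Y ω)) := hY.measure_eq measurableSet_Iic
    _ = ENNReal.ofReal (cdf ν (Y ω)) := (ofReal_cdf ν _).symm

theorem Comonotone.ae_eq_quantile (h : Comonotone P Y U) (hU : HasLaw U unif P) {ν : Measure ℝ}
    [IsProbabilityMeasure ν] (hY : HasLaw Y ν P) : Y =ᵐ[P] fun ω => quantile ν (U ω) := by
  have := hU.isProbabilityMeasure
  have hlaw : HasLaw (fun ω => quantile ν (U ω)) ν P := (hasLaw_quantile ν).fun_comp hU
  refine (ae_eq_of_ae_le_of_identDistrib ?_ (hlaw.identDistrib hY)).symm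
  filter_upwards [h.le_cdf hU hY, ae_mem_Ioo_of_hasLaw hU] with ω hω hUω
  exact (quantile_le_iff ν hUω _).2 hω

end Quantile

section Transfer

open unitInterval

variable {Ω 𝓧 𝓨 : Type*} [MeasurableSpace Ω] [MeasurableSpace 𝓧] [MeasurableSpace 𝓨]
  {P : Measure Ω}

theorem hasLaw_projIcc {V : Ω → ℝ} (hV : HasLaw V unif P) :
    HasLaw (fun ω => projIcc (0 : ℝ) 1 zero_le_one (V ω)) (volume : Measure I) P := by
  have hproj : HasLaw (projIcc (0 : ℝ) 1 zero_le_one) (volume : Measure I) unif := by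
    refine ⟨by fun_prop, ?_⟩
    rw [unif, ← map_comap_subtype_coe measurableSet_Icc,
      Measure.map_map (by fun_prop) measurable_subtype_coe]
    have hval : projIcc (0 : ℝ) 1 zero_le_one ∘ Subtype.val = id :=
      funext fun x => projIcc_val zero_le_one x
    rw [hval, Measure.map_id]
    rfl
  exact hproj.fun_comp hV

theorem hasLaw_prodMk_compProd {𝓣 : Type*} [MeasurableSpace 𝓣] (ν : Measure 𝓨) [SFinite ν]
    (τ : Measure 𝓣) [SFinite τ] {κ : Kernel 𝓨 𝓧} [IsSFiniteKernel κ] {h : 𝓨 → 𝓣 → 𝓧}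
    (hh : Measurable (Function.uncurry h)) (hκ : ∀ y, τ.map (h y) = κ y) :
    HasLaw (fun z : 𝓨 × 𝓣 => (z.1, h z.1 z.2)) (ν ⊗ₘ κ) (ν.prod τ) := by
  have hmeas : Measurable fun z : 𝓨 × 𝓣 => (z.1, h z.1 z.2) := measurable_fst.prodMk hh
  refine ⟨hmeas.aemeasurable, Measure.ext fun s hs => ?_⟩
  rw [Measure.map_apply hmeas hs, Measure.prod_apply (hmeas hs), Measure.compProd_apply hs]
  refine lintegral_congr fun y => ?_
  have hy : Measurable (h y) := hh.comp measurable_prodMk_left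
  rw [← hκ y, Measure.map_apply hy (measurable_prodMk_left hs)]
  rfl

theorem exists_hasLaw_prodMk_compProd [IsProbabilityMeasure P] [StandardBorelSpace 𝓧] [Nonempty 𝓧]
    {ν : Measure 𝓨} (κ : Kernel 𝓨 𝓧) [IsMarkovKernel κ] {W : Ω → 𝓨} {V : Ω → ℝ}
    (hW : HasLaw W ν P) (hV : HasLaw V unif P) (hWV : IndepFun W V P) :
    ∃ X : Ω → 𝓧, HasLaw (fun ω => (W ω, X ω)) (ν ⊗ₘ κ) P := by
  obtain ⟨h, hh, hκ⟩ := Kernel.exists_measurable_map_eq_unitInterval κ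
  have := hW.isProbabilityMeasure_iff.1 ‹_›
  have hind : IndepFun W (fun ω => projIcc (0 : ℝ) 1 zero_le_one (V ω)) P :=
    hWV.comp measurable_id continuous_projIcc.measurable
  exact ⟨_, (hasLaw_prodMk_compProd ν volume hh hκ).fun_comp
    (hind.hasLaw_prod hW (hasLaw_projIcc hV))⟩

-- Given `W = φ(X)`, the variable `X` is drawn from its conditional law with `V` as random seed.
theorem exists_hasLaw_comp_ae_eq [IsProbabilityMeasure P] [StandardBorelSpace 𝓧] [Nonempty 𝓧]
    [MeasurableEq 𝓨] (μ : Measure 𝓧) [IsProbabilityMeasure μ] {φ : 𝓧 → 𝓨} (hφ : Measurable φ)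
    {W : Ω → 𝓨} {V : Ω → ℝ} (hW : HasLaw W (μ.map φ) P) (hV : HasLaw V unif P)
    (hWV : IndepFun W V P) :
    ∃ X : Ω → 𝓧, HasLaw X μ P ∧ (fun ω => φ (X ω)) =ᵐ[P] W := by
  obtain ⟨X, hWX⟩ := exists_hasLaw_prodMk_compProd (condDistrib id φ μ) hW hV hWV
  have hgraph : HasLaw (fun x => (φ x, x)) ((μ.map φ) ⊗ₘ condDistrib id φ μ) μ :=
    ⟨by fun_prop, (compProd_map_condDistrib aemeasurable_id).symm⟩
  refine ⟨X, hgraph.comp_of_hasLaw_comp (f := Prod.snd) (by fun_prop) hWX .id, ?_⟩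
  have hmeas : Measurable fun z : 𝓨 × 𝓧 => φ z.2 = z.1 :=
    measurableSet_setOfPred.1 (measurableSet_eq_fun (hφ.comp measurable_snd) measurable_fst)
  exact (hWX.ae_iff hmeas).2 ((hgraph.ae_iff hmeas).1 (ae_of_all _ fun _ => rfl))

end Transfer

section Branches

open Filter Topology

variable {μ : Measure ℝ} {x y u u' c : ℝ}

theorem sub_le_g_sub (hx : x ∈ Ioo (0 : ℝ) 1) (hy : y ∈ Ioo (0 : ℝ) 1) (hxy : x ≤ y) :
    y - x ≤ g μ y - g μ x := by
  have := monotone_cdf μ (neg_le_neg (monotoneOn_quantile μ hx hy hxy))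
  simp only [g]
  linarith

theorem strictMonoOn_g : StrictMonoOn (g μ) (Ioo 0 1) := fun x hx y hy hxy => by
  have := sub_le_g_sub (μ := μ) hx hy hxy.le
  linarith

theorem one_le_deriv_g (hx : x ∈ Ioo (0 : ℝ) 1) (hd : DifferentiableAt ℝ (g μ) x) :
    1 ≤ deriv (g μ) x := by
  have hmono : MonotoneOn (fun z => g μ z - z) (Ioo 0 1) := fun y hy z hz hyz => by
    have := sub_le_g_sub (μ := μ) hy hz hyz
    linarith
  have hderiv : 0 ≤ deriv (fun z => g μ z - z) x := by
    rw [← derivWithin_of_isOpen isOpen_Ioo hx]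
    exact hmono.derivWithin_nonneg
  rw [deriv_fun_sub hd differentiableAt_fun_id, deriv_id''] at hderiv
  linarith

theorem quantile_le_neg_quantile_iff (hx : x ∈ Ioo (0 : ℝ) 1) :
    quantile μ x ≤ -quantile μ y ↔ x ≤ y - g μ y := by
  rw [quantile_le_iff μ hx, g, sub_sub_cancel]

theorem quantile_le_neg_quantile_iff' (hy : y ∈ Ioo (0 : ℝ) 1) :
    quantile μ x ≤ -quantile μ y ↔ y ≤ x - g μ x := by
  rw [le_neg, quantile_le_neg_quantile_iff hy]

theorem quantile_pos_iff (hx : x ∈ Ioo (0 : ℝ) 1) : 0 < quantile μ x ↔ 0 < g μ x := by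
  have h := (quantile_le_neg_quantile_iff (μ := μ) (y := x) hx).not
  rw [not_le, not_le, neg_lt_self_iff] at h
  rw [h, sub_lt_self_iff]

theorem fInv_eq_gInv_neg : fInv μ u = gInv μ (-u) := by
  -- `invFunOn` only depends on the predicate it chooses from, so this holds off the range as well.
  have h : (fun a => a ∈ Ioo (0 : ℝ) 1 ∧ f μ a = u) = fun a => a ∈ Ioo (0 : ℝ) 1 ∧ g μ a = -u :=
    funext fun a => propext (and_congr_right fun _ => neg_eq_iff_eq_neg)
  classical
  exact congrArg (fun p : ℝ → Prop => if h : ∃ a, p a then h.choose else Classical.choice ⟨0⟩) h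

theorem threshold_eq_div : threshold μ u = |deriv (g μ) (gInv μ u)| /
    (|deriv (g μ) (gInv μ (-u))| + |deriv (g μ) (gInv μ u)|) := by
  have hf : f μ = -g μ := rfl
  rw [threshold, fInv_eq_gInv_neg, hf, deriv.neg, abs_neg]

theorem gInv_mem (hu : u ∈ g μ '' Ioo 0 1) : gInv μ u ∈ Ioo (0 : ℝ) 1 :=
  Function.invFunOn_mem hu

theorem g_gInv (hu : u ∈ g μ '' Ioo 0 1) : g μ (gInv μ u) = u :=
  Function.invFunOn_eq hu

theorem strictMonoOn_gInv : StrictMonoOn (gInv μ) (g μ '' Ioo 0 1) := fun u hu u' hu' h =>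
  strictMonoOn_g.lt_iff_lt (gInv_mem hu) (gInv_mem hu') |>.1 (by rwa [g_gInv hu, g_gInv hu'])

theorem lipschitzOnWith_gInv : LipschitzOnWith 1 (gInv μ) (g μ '' Ioo 0 1) := by
  refine LipschitzOnWith.of_le_add fun u hu u' hu' => ?_
  rcases le_total u u' with h | h
  · have := strictMonoOn_gInv.monotoneOn hu hu' h
    linarith [dist_nonneg (x := u) (y := u')]
  · have := sub_le_g_sub (μ := μ) (gInv_mem hu') (gInv_mem hu)
      (strictMonoOn_gInv.monotoneOn hu' hu h)
    rw [g_gInv hu, g_gInv hu'] at this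
    linarith [Real.dist_eq u u', le_abs_self (u - u')]

theorem gInv_sub_gInv_neg (hu : u ∈ g μ '' Ioo 0 1) (hu' : -u ∈ g μ '' Ioo 0 1) :
    gInv μ u - gInv μ (-u) = u := by
  -- Both inequalities express `F⁻¹(g⁻¹(u)) ≤ -F⁻¹(g⁻¹(-u))`; as they bound `g⁻¹(u) - g⁻¹(-u)`
  -- by `u` from opposite sides, both hold.
  have h : gInv μ u ≤ gInv μ (-u) - -u ↔ gInv μ (-u) ≤ gInv μ u - u := by
    have h₁ := quantile_le_neg_quantile_iff (μ := μ) (y := gInv μ (-u)) (gInv_mem hu)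
    have h₂ := quantile_le_neg_quantile_iff' (μ := μ) (x := gInv μ u) (gInv_mem hu')
    rw [g_gInv hu'] at h₁
    rw [g_gInv hu] at h₂
    exact h₁.symm.trans h₂
  rcases le_total (gInv μ u) (gInv μ (-u) - -u) with hle | hle
  · linarith [h.1 hle]
  · linarith [h.2 (by linarith)]

theorem quantile_gInv_le (hu : u ∈ g μ '' Ioo 0 1) (hu' : -u ∈ g μ '' Ioo 0 1) :
    quantile μ (gInv μ u) ≤ -quantile μ (gInv μ (-u)) := by
  rw [quantile_le_neg_quantile_iff (gInv_mem hu), g_gInv hu']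
  linarith [gInv_sub_gInv_neg hu hu']

theorem neg_quantile_gInv_neg_lt (hu : -u ∈ g μ '' Ioo 0 1) (hu' : u' ∈ g μ '' Ioo 0 1)
    (hnu' : -u' ∈ g μ '' Ioo 0 1) (h : u < u') :
    -quantile μ (gInv μ (-u)) < quantile μ (gInv μ u') := by
  rw [← not_le, quantile_le_neg_quantile_iff' (gInv_mem hu), g_gInv hu']
  linarith [gInv_sub_gInv_neg hu' hnu', strictMonoOn_gInv hnu' hu (neg_lt_neg h)]

theorem measurableEmbedding_g : MeasurableEmbedding fun x : Ioo (0 : ℝ) 1 => g μ x := by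
  have hmono : StrictMono fun x : Ioo (0 : ℝ) 1 => g μ x := fun x y h =>
    strictMonoOn_g x.2 y.2 h
  have := measurableSet_Ioo (a := (0 : ℝ)) (b := 1) |>.standardBorel
  exact hmono.monotone.measurable.measurableEmbedding hmono.injective

theorem measurable_gInv : Measurable (gInv μ) := by
  have hext : gInv μ = Function.extend (fun x : Ioo (0 : ℝ) 1 => g μ x) Subtype.val
      fun _ => Classical.choice ⟨0⟩ := by
    funext u
    by_cases hu : u ∈ g μ '' Ioo 0 1
    · have := (measurableEmbedding_g (μ := μ)).injective.extend_apply Subtype.val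
        (fun _ => Classical.choice ⟨0⟩) ⟨gInv μ u, gInv_mem hu⟩
      simpa only [g_gInv hu] using this.symm
    · rw [Function.extend_apply']
      on_goal 2 => exact fun ⟨x, hx⟩ => hu ⟨x, x.2, hx⟩
      exact Function.invFunOn_neg hu
  rw [hext]
  exact measurableEmbedding_g.measurable_extend measurable_subtype_coe measurable_const

theorem measurable_threshold : Measurable (threshold μ) := by
  have h : Measurable fun u => |deriv (g μ) (gInv μ u)| :=
    ((measurable_deriv (g μ)).comp measurable_gInv).abs
  simp_rw [funext fun u => threshold_eq_div (μ := μ) (u := u)]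
  exact h.div ((h.comp measurable_neg).add h)

/-- The points of the range of `g` on `(0,1)` at whose preimage `g` is differentiable. -/
def regularValues (μ : Measure ℝ) : Set ℝ :=
  {u | u ∈ g μ '' Ioo 0 1 ∧ DifferentiableAt ℝ (g μ) (gInv μ u)}

theorem measurableSet_regularValues : MeasurableSet (regularValues μ) := by
  refine MeasurableSet.inter ?_ (measurable_gInv (measurableSet_of_differentiableAt ℝ (g μ)))
  rw [image_eq_range]
  exact measurableEmbedding_g.measurableSet_range

theorem one_le_deriv_g_gInv (hu : u ∈ regularValues μ) : 1 ≤ deriv (g μ) (gInv μ u) :=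
  one_le_deriv_g (gInv_mem hu.1) hu.2

theorem hasDerivWithinAt_gInv (hu : u ∈ regularValues μ) :
    HasDerivWithinAt (gInv μ) (deriv (g μ) (gInv μ u))⁻¹ (g μ '' Ioo 0 1) u := by
  have hne : deriv (g μ) (gInv μ u) ≠ 0 := (zero_lt_one.trans_le (one_le_deriv_g_gInv hu)).ne'
  have h := HasFDerivWithinAt.of_local_left_inverse (t := univ) (g := gInv μ) (a := u)
    (by rw [nhdsWithin_univ]; exact lipschitzOnWith_gInv.continuousOn u hu.1)
    (hu.2.hasDerivAt.hasFDerivAt_equiv hne).hasFDerivWithinAt hu.1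
    (by filter_upwards [self_mem_nhdsWithin] with y hy using g_gInv hy)
  exact (hasFDerivWithinAt_iff_hasDerivWithinAt.1 h).congr_deriv (by simp)

/-- The points of `(0,c)` at which both inverse branches `gInv u` and `fInv u = gInv (-u)` are
regular: `InverseBranches μ c` says that these fill `(0,c)` up to a null set. -/
def branchSet (μ : Measure ℝ) (c : ℝ) : Set ℝ :=
  {u ∈ Ioo 0 c | u ∈ regularValues μ ∧ -u ∈ regularValues μ}

theorem measurableSet_branchSet : MeasurableSet (branchSet μ c) :=
  measurableSet_Ioo.inter
    (measurableSet_regularValues.inter (measurable_neg measurableSet_regularValues))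

theorem InverseBranches.branchSet_ae_eq (h : InverseBranches μ c) :
    branchSet μ c =ᵐ[volume] Ioo 0 c := by
  rw [InverseBranches, ae_restrict_iff' measurableSet_Ioo] at h
  filter_upwards [h] with u hu
  refine propext ⟨And.left, fun huc => ⟨huc, (hu huc).1, ?_⟩⟩
  obtain ⟨-, ⟨x, hx, hxu⟩, hdiff⟩ := hu huc
  rw [fInv_eq_gInv_neg] at hdiff
  exact ⟨⟨x, hx, by rw [← hxu, f, neg_neg]⟩, differentiableAt_neg_iff.1 hdiff⟩

theorem uniqueDiffWithinAt_of_ae_eq {s t : Set ℝ} (ht : IsOpen t) (hst : s =ᵐ[volume] t)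
    (hx : x ∈ t) : UniqueDiffWithinAt ℝ s x := by
  have hdense : Dense {y | y ∈ t → y ∈ s} :=
    Measure.dense_of_ae (hst.mem_iff.mono fun _ h => h.2)
  have hsub : t ⊆ closure s :=
    (hdense.open_subset_closure_inter ht).trans (closure_mono fun y hy => hy.2 hy.1)
  exact uniqueDiffWithinAt_closure.1 ((ht.uniqueDiffWithinAt hx).mono hsub)

theorem hasDerivWithinAt_gInv_branchSet (hu : u ∈ branchSet μ c) :
    HasDerivWithinAt (gInv μ) (deriv (g μ) (gInv μ u))⁻¹ (branchSet μ c) u :=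
  (hasDerivWithinAt_gInv hu.2.1).mono fun _ hv => hv.2.1.1

theorem hasDerivWithinAt_gInv_neg_branchSet (hu : u ∈ branchSet μ c) :
    HasDerivWithinAt (fun v => gInv μ (-v)) (-(deriv (g μ) (gInv μ (-u)))⁻¹) (branchSet μ c) u := by
  have h := (hasDerivWithinAt_gInv hu.2.2).comp u (hasDerivWithinAt_neg u (branchSet μ c))
    fun _ hv => hv.2.2.1
  rwa [mul_neg_one] at h

theorem inv_deriv_add_inv_deriv (h : InverseBranches μ c) (hu : u ∈ branchSet μ c) :
    (deriv (g μ) (gInv μ u))⁻¹ + (deriv (g μ) (gInv μ (-u)))⁻¹ = 1 := by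
  have hid : HasDerivWithinAt (fun v => gInv μ v - gInv μ (-v)) 1 (branchSet μ c) u :=
    (hasDerivWithinAt_id u _).congr (fun v hv => gInv_sub_gInv_neg hv.2.1.1 hv.2.2.1)
      (gInv_sub_gInv_neg hu.2.1.1 hu.2.2.1)
  have hunique := uniqueDiffWithinAt_of_ae_eq isOpen_Ioo h.branchSet_ae_eq hu.1
  rw [← hunique.eq_deriv _ ((hasDerivWithinAt_gInv_branchSet hu).sub
    (hasDerivWithinAt_gInv_neg_branchSet hu)) hid, sub_neg_eq_add]

theorem threshold_eq_inv_deriv (h : InverseBranches μ c) (hu : u ∈ branchSet μ c) :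
    threshold μ u = (deriv (g μ) (gInv μ (-u)))⁻¹ := by
  have hsum := inv_deriv_add_inv_deriv h hu
  have ha := one_le_deriv_g_gInv hu.2.1
  have hb := one_le_deriv_g_gInv hu.2.2
  rw [threshold_eq_div, abs_of_pos (by linarith), abs_of_pos (by linarith)]
  have ha' : deriv (g μ) (gInv μ u) ≠ 0 := by linarith
  have hb' : deriv (g μ) (gInv μ (-u)) ≠ 0 := by linarith
  field_simp at hsum
  rw [hsum, div_mul_cancel_left₀ ha']

end Branches

section Mixture

open Filter
open scoped ENNReal

variable {μ : Measure ℝ} {c : ℝ} {D : Set ℝ} {F : ℝ → ℝ≥0∞}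

theorem threshold_mem_Icc (h : InverseBranches μ c) {u : ℝ} (hu : u ∈ branchSet μ c) :
    threshold μ u ∈ Icc (0 : ℝ) 1 := by
  have hb := one_le_deriv_g_gInv hu.2.2
  rw [threshold_eq_inv_deriv h hu]
  exact ⟨inv_nonneg.2 (by linarith), inv_le_one_of_one_le₀ hb⟩

theorem injOn_gInv_branchSet : InjOn (gInv μ) (branchSet μ c) :=
  strictMonoOn_gInv.injOn.mono fun _ hu => hu.2.1.1

theorem injOn_gInv_neg_branchSet : InjOn (fun u => gInv μ (-u)) (branchSet μ c) :=
  fun _ hu _ hu' heq => neg_injective (strictMonoOn_gInv.injOn hu.2.2.1 hu'.2.2.1 heq)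

theorem measurableSet_gInv_image_branchSet : MeasurableSet (gInv μ '' branchSet μ c) :=
  measurableSet_branchSet.image_of_measurable_injOn measurable_gInv injOn_gInv_branchSet

theorem measurableSet_gInv_neg_image_branchSet :
    MeasurableSet ((fun u => gInv μ (-u)) '' branchSet μ c) :=
  measurableSet_branchSet.image_of_measurable_injOn (measurable_gInv.comp measurable_neg)
    injOn_gInv_neg_branchSet

theorem setLIntegral_gInv_image (h : InverseBranches μ c) (F : ℝ → ℝ≥0∞) :
    ∫⁻ x in gInv μ '' branchSet μ c, F x =
      ∫⁻ u in branchSet μ c, ENNReal.ofReal (1 - threshold μ u) * F (gInv μ u) := by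
  rw [lintegral_image_eq_lintegral_abs_deriv_mul measurableSet_branchSet
    (fun u hu => hasDerivWithinAt_gInv_branchSet hu) injOn_gInv_branchSet]
  refine setLIntegral_congr_fun measurableSet_branchSet fun u hu => ?_
  have ha := one_le_deriv_g_gInv hu.2.1
  rw [threshold_eq_inv_deriv h hu, ← inv_deriv_add_inv_deriv h hu, add_sub_cancel_right,
    abs_of_nonneg (inv_nonneg.2 (by linarith))]

theorem setLIntegral_gInv_neg_image (h : InverseBranches μ c) (F : ℝ → ℝ≥0∞) :
    ∫⁻ x in (fun u => gInv μ (-u)) '' branchSet μ c, F x =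
      ∫⁻ u in branchSet μ c, ENNReal.ofReal (threshold μ u) * F (gInv μ (-u)) := by
  rw [lintegral_image_eq_lintegral_abs_deriv_mul measurableSet_branchSet
    (fun u hu => hasDerivWithinAt_gInv_neg_branchSet hu) injOn_gInv_neg_branchSet]
  refine setLIntegral_congr_fun measurableSet_branchSet fun u hu => ?_
  have hb := one_le_deriv_g_gInv hu.2.2
  rw [threshold_eq_inv_deriv h hu, abs_neg, abs_of_nonneg (inv_nonneg.2 (by linarith))]

theorem setLIntegral_gInv_union (h : InverseBranches μ c) (hF : Measurable F) :
    ∫⁻ x in gInv μ '' branchSet μ c ∪ (fun u => gInv μ (-u)) '' branchSet μ c, F x =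
      ∫⁻ u in branchSet μ c, (ENNReal.ofReal (1 - threshold μ u) * F (gInv μ u) +
        ENNReal.ofReal (threshold μ u) * F (gInv μ (-u))) := by
  have hdisj : Disjoint (gInv μ '' branchSet μ c) ((fun u => gInv μ (-u)) '' branchSet μ c) := by
    rw [Set.disjoint_left]
    rintro _ ⟨u, hu, rfl⟩ ⟨u', hu', heq⟩
    have : -u' = u := by rw [← g_gInv hu.2.1.1, ← g_gInv hu'.2.2.1]; exact congrArg (g μ) heq
    linarith [hu.1.1, hu'.1.1]
  rw [lintegral_union measurableSet_gInv_neg_image_branchSet hdisj, setLIntegral_gInv_image h,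
    setLIntegral_gInv_neg_image h, lintegral_add_left]
  exact (measurable_threshold.const_sub 1).ennreal_ofReal.mul (hF.comp measurable_gInv)

theorem gInv_union_ae_eq (h : InverseBranches μ c) (hD : volume D = ENNReal.ofReal c)
    (hg : MapsTo (gInv μ) (branchSet μ c) D)
    (hg' : MapsTo (fun u => gInv μ (-u)) (branchSet μ c) D) :
    (gInv μ '' branchSet μ c ∪ (fun u => gInv μ (-u)) '' branchSet μ c : Set ℝ) =ᵐ[volume] D := by
  have hvol : volume (gInv μ '' branchSet μ c ∪ (fun u => gInv μ (-u)) '' branchSet μ c) =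
      ENNReal.ofReal c := by
    calc _ = ∫⁻ u in branchSet μ c, (ENNReal.ofReal (1 - threshold μ u) * 1 +
          ENNReal.ofReal (threshold μ u) * 1) := by
          rw [← setLIntegral_one]
          exact setLIntegral_gInv_union h measurable_const
      _ = ∫⁻ _ in branchSet μ c, 1 := by
          refine setLIntegral_congr_fun measurableSet_branchSet fun u hu => ?_
          obtain ⟨h₀, h₁⟩ := threshold_mem_Icc h hu
          simp only [mul_one]
          rw [← ENNReal.ofReal_add (by linarith) h₀, sub_add_cancel, ENNReal.ofReal_one]
      _ = ENNReal.ofReal c := by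
          rw [setLIntegral_one, measure_congr h.branchSet_ae_eq, Real.volume_Ioo, sub_zero]
  exact ae_eq_of_subset_of_measure_ge (union_subset hg.image_subset hg'.image_subset)
    (by rw [hvol, hD])
    (measurableSet_gInv_image_branchSet.union
      measurableSet_gInv_neg_image_branchSet).nullMeasurableSet
    (by rw [hD]; exact ENNReal.ofReal_ne_top)

theorem lintegral_unif_ite {p : ℝ} (hp : p ∈ Icc (0 : ℝ) 1) (a b : ℝ≥0∞) :
    ∫⁻ v, (if p < v then a else b) ∂unif = ENNReal.ofReal (1 - p) * a + ENNReal.ofReal p * b := by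
  have hIoi : unif (Iic p)ᶜ = ENNReal.ofReal (1 - p) := by
    rw [prob_compl_eq_one_sub measurableSet_Iic, unif_Iic hp.2, ENNReal.ofReal_sub 1 hp.1,
      ENNReal.ofReal_one]
  have hlow : ∫⁻ v in Iic p, (if p < v then a else b) ∂unif = ENNReal.ofReal p * b := by
    rw [setLIntegral_congr_fun measurableSet_Iic fun v hv => if_neg (not_lt.2 hv),
      setLIntegral_const, unif_Iic hp.2, mul_comm]
  have hhigh : ∫⁻ v in (Iic p)ᶜ, (if p < v then a else b) ∂unif = ENNReal.ofReal (1 - p) * a := by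
    rw [setLIntegral_congr_fun measurableSet_Iic.compl fun v hv => if_pos (not_le.1 hv),
      setLIntegral_const, hIoi, mul_comm]
  rw [← lintegral_add_compl _ measurableSet_Iic, hlow, hhigh, add_comm]

theorem unif_eq_add (hc : c ∈ Icc (0 : ℝ) 1) :
    unif = volume.restrict (Ioo 0 c) + volume.restrict (Ioo c 1) := by
  rw [unif, restrict_Ioo_eq_restrict_Ioc, restrict_Ioo_eq_restrict_Ioc,
    ← restrict_Ioc_eq_restrict_Icc, ← Ioc_union_Ioc_eq_Ioc hc.1 hc.2,
    Measure.restrict_union (Ioc_disjoint_Ioc_of_le le_rfl) measurableSet_Ioc]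

/-- The two inverse branches, mixed by `v` according to `threshold`, below the level `c`, and `τ`
above it: the common form of `evenCaseI` and `evenCaseK`. -/
noncomputable def branchMixture (μ : Measure ℝ) (c : ℝ) (τ : ℝ → ℝ) (z : ℝ × ℝ) : ℝ :=
  if c < z.1 then τ z.1 else if threshold μ z.1 < z.2 then gInv μ z.1 else gInv μ (-z.1)

variable {τ : ℝ → ℝ}

theorem measurable_branchMixture (hτ : Measurable τ) : Measurable (branchMixture μ c τ) :=
  .ite (measurableSet_lt measurable_const measurable_fst) (hτ.comp measurable_fst) <|
    .ite (measurableSet_lt (measurable_threshold.comp measurable_fst) measurable_snd)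
      (measurable_gInv.comp measurable_fst) (measurable_gInv.comp measurable_fst.neg)

theorem hasLaw_branchMixture (hc : c ∈ Icc (0 : ℝ) 1) (h : InverseBranches μ c)
    (hD : volume D = ENNReal.ofReal c) (hg : MapsTo (gInv μ) (branchSet μ c) D)
    (hg' : MapsTo (fun u => gInv μ (-u)) (branchSet μ c) D) (hτ : Measurable τ)
    (hDτ : volume.restrict D + (volume.restrict (Ioo c 1)).map τ = unif) :
    HasLaw (branchMixture μ c τ) unif (unif.prod unif) := by
  refine ⟨(measurable_branchMixture hτ).aemeasurable, Measure.ext_of_lintegral _ fun F hF => ?_⟩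
  have hlow : ∫⁻ u in Ioo 0 c, ∫⁻ v, F (branchMixture μ c τ (u, v)) ∂unif =
      ∫⁻ x in D, F x := by
    rw [← setLIntegral_congr (gInv_union_ae_eq h hD hg hg'), setLIntegral_gInv_union h hF,
      ← setLIntegral_congr h.branchSet_ae_eq]
    refine setLIntegral_congr_fun measurableSet_branchSet fun u hu => ?_
    rw [← lintegral_unif_ite (threshold_mem_Icc h hu)]
    simp only [branchMixture, not_lt.2 hu.1.2.le, if_false, apply_ite F]
  have hhigh : ∫⁻ u in Ioo c 1, ∫⁻ v, F (branchMixture μ c τ (u, v)) ∂unif =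
      ∫⁻ u in Ioo c 1, F (τ u) := by
    refine setLIntegral_congr_fun measurableSet_Ioo fun u hu => ?_
    simp only [branchMixture, hu.1, if_true, lintegral_const, measure_univ, mul_one]
  have hmeas : Measurable fun z => F (branchMixture μ c τ z) :=
    hF.comp (measurable_branchMixture hτ)
  calc ∫⁻ x, F x ∂(unif.prod unif).map (branchMixture μ c τ)
      = ∫⁻ u, ∫⁻ v, F (branchMixture μ c τ (u, v)) ∂unif ∂unif := by
        rw [lintegral_map hF (measurable_branchMixture hτ),
          lintegral_prod _ hmeas.aemeasurable]
    _ = (∫⁻ x in D, F x) + ∫⁻ u in Ioo c 1, F (τ u) := by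
        rw [← hlow, ← hhigh, ← lintegral_add_measure, ← unif_eq_add hc]
    _ = ∫⁻ x, F x ∂unif := by
        rw [← lintegral_map hF hτ, ← lintegral_add_measure, hDτ]

end Mixture

section BranchMonotonicity

variable {Ω : Type*} [MeasurableSpace Ω] {P : Measure Ω} {U V : Ω → ℝ} {μ : Measure ℝ} {c : ℝ}
  {τ : ℝ → ℝ} {z z' : ℝ × ℝ}

theorem abs_quantile_branchMixture_mem_Icc (hz : z.1 ∈ branchSet μ c) :
    |quantile μ (branchMixture μ c τ z)| ∈
      Icc (quantile μ (gInv μ z.1)) (-quantile μ (gInv μ (-z.1))) := by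
  obtain ⟨hu, ⟨hr, -⟩, ⟨hr', -⟩⟩ := hz
  have hpos : 0 < quantile μ (gInv μ z.1) := by
    rw [quantile_pos_iff (gInv_mem hr), g_gInv hr]
    exact hu.1
  have hle := quantile_gInv_le hr hr'
  rw [branchMixture, if_neg (not_lt.2 hu.2.le)]
  split_ifs
  · rw [abs_of_pos hpos]
    exact ⟨le_rfl, hle⟩
  · rw [abs_of_neg (by linarith)]
    exact ⟨hle, le_rfl⟩

theorem abs_quantile_branchMixture_le
    (hbound : ∀ u ∈ branchSet μ c, ∀ u' ∈ Ioo c 1,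
      -quantile μ (gInv μ (-u)) ≤ |quantile μ (τ u')|)
    (hτ : MonotoneOn (fun u => |quantile μ (τ u)|) (Ioo c 1))
    (hz : z.1 ∈ branchSet μ c ∪ Ioo c 1) (hz' : z'.1 ∈ branchSet μ c ∪ Ioo c 1)
    (h : z.1 < z'.1) :
    |quantile μ (branchMixture μ c τ z)| ≤ |quantile μ (branchMixture μ c τ z')| := by
  have hhigh {y : ℝ × ℝ} (hy : y.1 ∈ Ioo c 1) : branchMixture μ c τ y = τ y.1 := if_pos hy.1
  rcases hz with hz | hz <;> rcases hz' with hz' | hz'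
  · exact (abs_quantile_branchMixture_mem_Icc hz).2.trans <|
      (neg_quantile_gInv_neg_lt hz.2.2.1 hz'.2.1.1 hz'.2.2.1 h).le.trans
        (abs_quantile_branchMixture_mem_Icc hz').1
  · rw [hhigh hz']
    exact (abs_quantile_branchMixture_mem_Icc hz).2.trans (hbound _ hz _ hz')
  · exact absurd (hz.1.trans h) (not_lt.2 hz'.1.2.le)
  · rw [hhigh hz, hhigh hz']
    exact hτ hz hz' h.le

theorem ae_mem_branchSet_union (hU : HasLaw U unif P) (hc : c ∈ Icc (0 : ℝ) 1)
    (h : InverseBranches μ c) : ∀ᵐ ω ∂P, U ω ∈ branchSet μ c ∪ Ioo c 1 := by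
  refine ae_of_ae_map hU.aemeasurable ?_
  rw [hU.map_eq, unif_eq_add hc, ae_add_measure_iff]
  constructor
  · filter_upwards [ae_restrict_mem measurableSet_Ioo,
      ae_restrict_of_ae h.branchSet_ae_eq.mem_iff] with u hu hiff using Or.inl (hiff.2 hu)
  · filter_upwards [ae_restrict_mem measurableSet_Ioo] with u hu using Or.inr hu

theorem comonotone_quantile_branchMixture_pow (hU : HasLaw U unif P) (hc : c ∈ Icc (0 : ℝ) 1)
    (h : InverseBranches μ c)
    (hbound : ∀ u ∈ branchSet μ c, ∀ u' ∈ Ioo c 1,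
      -quantile μ (gInv μ (-u)) ≤ |quantile μ (τ u')|)
    (hτ : MonotoneOn (fun u => |quantile μ (τ u)|) (Ioo c 1)) {d : ℕ} (hd : Even d) :
    Comonotone P (fun ω => quantile μ (branchMixture μ c τ (U ω, V ω)) ^ d) U := by
  refine ⟨_, ae_mem_branchSet_union hU hc h, fun ω hω ω' hω' hlt => ?_⟩
  simp only [← hd.pow_abs (quantile μ _)]
  exact pow_le_pow_left₀ (abs_nonneg _) (abs_quantile_branchMixture_le
    (z := (U ω, V ω)) (z' := (U ω', V ω')) hbound hτ hω hω' hlt) d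

end BranchMonotonicity

section Levels

open Filter Topology

variable {Ω : Type*} [MeasurableSpace Ω] {P : Measure Ω} {U V : Ω → ℝ} {μ : Measure ℝ}
  {x u : ℝ}

theorem evenCaseI_eq_branchMixture (u v : ℝ) :
    evenCaseI μ u v = branchMixture μ (levelI μ) id (u, v) := by
  simp only [evenCaseI, branchMixture, I, J, fInv_eq_gInv_neg]
  split_ifs <;> simp

theorem evenCaseK_eq_branchMixture (u v : ℝ) :
    evenCaseK μ u v = branchMixture μ (levelK μ) (fun u => 1 - u) (u, v) := by
  simp only [evenCaseK, branchMixture, K, J, fInv_eq_gInv_neg]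
  split_ifs <;> simp

variable [IsProbabilityMeasure μ]

theorem levelI_mem_Icc : levelI μ ∈ Icc (0 : ℝ) 1 := ⟨measureReal_nonneg, measureReal_le_one⟩

theorem levelK_mem_Icc : levelK μ ∈ Icc (0 : ℝ) 1 :=
  ⟨sub_nonneg.2 measureReal_le_one, sub_le_self _ measureReal_nonneg⟩

theorem cdfExt_coe (y : ℝ) : cdfExt μ y = cdf μ y := by
  rw [cdf_eq_real]
  simp only [cdfExt, EReal.coe_le_coe_iff]
  rfl

theorem monotone_cdfExt : Monotone (cdfExt μ) := fun _ _ h =>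
  measureReal_mono fun _ hz => le_trans hz h

theorem g_eq_self_of_levelI_lt (hx : x ∈ Ioo (0 : ℝ) 1) (h : levelI μ < x) : g μ x = x := by
  have hcdf : cdf μ (-quantile μ x) = 0 := by
    by_contra hne
    have hlow : lowerEnd μ ≤ -(quantile μ x : EReal) :=
      sInf_le ⟨_, (cdf_nonneg μ _).lt_of_ne' hne, rfl⟩
    have hle := monotone_cdfExt (μ := μ) (EReal.le_neg_of_le_neg hlow)
    rw [cdfExt_coe] at hle
    exact h.not_ge ((le_cdf_quantile μ hx).trans hle)
  rw [g, hcdf, sub_zero]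

theorem g_eq_sub_one_of_lt_levelK (hx : x ∈ Ioo (0 : ℝ) 1) (h : x < 1 - levelK μ) :
    g μ x = x - 1 := by
  have hcdf : cdf μ (-quantile μ x) = 1 := by
    by_contra hne
    have hright : Tendsto (cdf μ) (𝓝[>] (-quantile μ x)) (𝓝 (cdf μ (-quantile μ x))) :=
      ((cdf μ).right_continuous _).mono Ioi_subset_Ici_self
    obtain ⟨z, hz, hqz : -quantile μ x < z⟩ :=
      ((hright.eventually (eventually_lt_nhds ((cdf_le_one μ _).lt_of_ne hne))).and
        self_mem_nhdsWithin).exists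
    have hup : (z : EReal) ≤ upperEnd μ := le_sSup ⟨z, hz, rfl⟩
    have hle := monotone_cdfExt (μ := μ) (EReal.neg_le_neg_iff.2 hup)
    rw [← EReal.coe_neg, cdfExt_coe] at hle
    have hlt := (lt_quantile_iff μ hx (-z)).1 (by linarith)
    rw [levelK, sub_sub_cancel] at h
    linarith
  rw [g, hcdf]

theorem gInv_le_levelI (hu : u ∈ g μ '' Ioo 0 1) (h : u ≤ levelI μ) : gInv μ u ≤ levelI μ := by
  by_contra! hlt
  have := g_eq_self_of_levelI_lt (gInv_mem hu) hlt
  rw [g_gInv hu] at this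
  linarith

theorem one_sub_levelK_le_gInv (hu : u ∈ g μ '' Ioo 0 1) (h : -levelK μ ≤ u) :
    1 - levelK μ ≤ gInv μ u := by
  by_contra! hlt
  have := g_eq_sub_one_of_lt_levelK (gInv_mem hu) hlt
  rw [g_gInv hu] at this
  linarith

theorem hasLaw_branchMixture_levelI (h : InverseBranches μ (levelI μ)) :
    HasLaw (branchMixture μ (levelI μ) id) unif (unif.prod unif) := by
  refine hasLaw_branchMixture (D := Ioc 0 (levelI μ)) levelI_mem_Icc h
    (by rw [Real.volume_Ioc, sub_zero])
    (fun u hu => ⟨(gInv_mem hu.2.1.1).1, gInv_le_levelI hu.2.1.1 hu.1.2.le⟩)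
    (fun u hu => ⟨(gInv_mem hu.2.2.1).1, gInv_le_levelI hu.2.2.1 (by linarith [hu.1.1, hu.1.2])⟩)
    measurable_id ?_
  rw [Measure.map_id, unif_eq_add (levelI_mem_Icc (μ := μ)),
    restrict_Ioo_eq_restrict_Ioc (a := 0)]

theorem hasLaw_branchMixture_levelK (h : InverseBranches μ (levelK μ)) :
    HasLaw (branchMixture μ (levelK μ) fun u => 1 - u) unif (unif.prod unif) := by
  refine hasLaw_branchMixture (D := Ico (1 - levelK μ) 1) levelK_mem_Icc h
    (by rw [Real.volume_Ico, sub_sub_cancel])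
    (fun u hu => ⟨one_sub_levelK_le_gInv hu.2.1.1 (by linarith [hu.1.1, hu.1.2]),
      (gInv_mem hu.2.1.1).2⟩)
    (fun u hu => ⟨one_sub_levelK_le_gInv hu.2.2.1 (by linarith [hu.1.2]),
      (gInv_mem hu.2.2.1).2⟩)
    (measurable_const.sub measurable_id) ?_
  have hmap := ((Measure.measurePreserving_sub_left volume (1 : ℝ)).restrict_preimage
    (s := Ioo 0 (1 - levelK μ)) measurableSet_Ioo).map_eq
  rw [preimage_const_sub_Ioo, sub_zero, sub_sub_cancel] at hmap
  rw [hmap, add_comm, unif_eq_add (Icc.mem_iff_one_sub_mem.1 (levelK_mem_Icc (μ := μ))),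
    restrict_Ioo_eq_restrict_Ico (b := 1)]

theorem comonotone_branchMixture_levelI_pow (hU : HasLaw U unif P)
    (h : InverseBranches μ (levelI μ)) {d : ℕ} (hd : Even d) :
    Comonotone P (fun ω => quantile μ (branchMixture μ (levelI μ) id (U ω, V ω)) ^ d) U := by
  have hmem {u : ℝ} (hu : u ∈ Ioo (levelI μ) 1) : u ∈ Ioo (0 : ℝ) 1 :=
    ⟨levelI_mem_Icc.1.trans_lt hu.1, hu.2⟩
  have habs {u : ℝ} (hu : u ∈ Ioo (levelI μ) 1) : |quantile μ u| = quantile μ u := by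
    refine abs_of_pos ?_
    rw [quantile_pos_iff (hmem hu), g_eq_self_of_levelI_lt (hmem hu) hu.1]
    exact (hmem hu).1
  refine comonotone_quantile_branchMixture_pow hU levelI_mem_Icc h (fun u hu u' hu' => ?_)
    (fun u hu u' hu' huu' => ?_) hd
  · have hx := gInv_mem hu.2.2.1
    have hnot : ¬quantile μ (gInv μ (-u)) ≤ -quantile μ u' := by
      rw [quantile_le_neg_quantile_iff hx, g_eq_self_of_levelI_lt (hmem hu') hu'.1, sub_self]
      exact not_le.2 hx.1
    rw [id, habs hu']
    linarith
  · simp only [id, habs hu, habs hu']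
    exact monotoneOn_quantile μ (hmem hu) (hmem hu') huu'

theorem comonotone_branchMixture_levelK_pow (hU : HasLaw U unif P)
    (h : InverseBranches μ (levelK μ)) {d : ℕ} (hd : Even d) :
    Comonotone P
      (fun ω => quantile μ (branchMixture μ (levelK μ) (fun u => 1 - u) (U ω, V ω)) ^ d) U := by
  have hmem {u : ℝ} (hu : u ∈ Ioo (levelK μ) 1) : 1 - u ∈ Ioo (0 : ℝ) 1 :=
    Ioo.mem_iff_one_sub_mem.1 ⟨levelK_mem_Icc.1.trans_lt hu.1, hu.2⟩
  have habs {u : ℝ} (hu : u ∈ Ioo (levelK μ) 1) : |quantile μ (1 - u)| = -quantile μ (1 - u) := by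
    refine abs_of_nonpos (not_lt.1 ?_)
    rw [quantile_pos_iff (hmem hu), g_eq_sub_one_of_lt_levelK (hmem hu) (by linarith [hu.1])]
    linarith [(hmem hu).2]
  refine comonotone_quantile_branchMixture_pow hU levelK_mem_Icc h (fun u hu u' hu' => ?_)
    (fun u hu u' hu' huu' => ?_) hd
  · rw [habs hu', neg_le_neg_iff]
    have hle := one_sub_levelK_le_gInv hu.2.2.1 (by linarith [hu.1.2])
    exact monotoneOn_quantile μ (hmem hu') (gInv_mem hu.2.2.1) (by linarith [hu'.1])
  · simp only [habs hu, habs hu']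
    exact neg_le_neg (monotoneOn_quantile μ (hmem hu') (hmem hu) (by linarith))

end Levels

section Attainment

variable {Ω : Type*} [MeasurableSpace Ω] {P : Measure Ω} {μ μ₁ μ₂ : Measure ℝ} {d : ℕ}
  {X₁ X₂ U V U₁ U₂ : Ω → ℝ}

theorem hasLaw_pow (hX : HasLaw X₁ μ P) (d : ℕ) : HasLaw (fun ω => X₁ ω ^ d) (powLaw μ d) P :=
  HasLaw.fun_comp (Y := fun x : ℝ => x ^ d) ⟨by fun_prop, rfl⟩ hX

instance isProbabilityMeasure_powLaw [IsProbabilityMeasure μ] (d : ℕ) :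
    IsProbabilityMeasure (powLaw μ d) :=
  Measure.isProbabilityMeasure_map (by fun_prop)

variable [IsProbabilityMeasure μ₁] [IsProbabilityMeasure μ₂]

theorem integral_mem_mixedMoments (hU₁ : HasLaw U₁ unif P) (hU : HasLaw U unif P)
    (hV : HasLaw V unif P) (hUV : IndepFun U V P)
    (hint : Integrable (fun ω => quantile μ₁ (U₁ ω) * quantile (powLaw μ₂ d) (U ω)) P) :
    ∫ ω, quantile μ₁ (U₁ ω) * quantile (powLaw μ₂ d) (U ω) ∂P ∈ mixedMoments P μ₁ μ₂ d := by
  have := hU.isProbabilityMeasure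
  have hquantile := hasLaw_quantile (powLaw μ₂ d)
  have hindep : IndepFun (fun ω => quantile (powLaw μ₂ d) (U ω)) V P :=
    hUV.comp₀ (φ := quantile (powLaw μ₂ d)) (ψ := id) hU.aemeasurable hV.aemeasurable
      (hU.map_eq.symm ▸ hquantile.aemeasurable) aemeasurable_id
  obtain ⟨X₂, hX₂, hae⟩ := exists_hasLaw_comp_ae_eq μ₂ (φ := fun x => x ^ d) (by fun_prop)
    (hquantile.fun_comp hU) hV hindep
  have hprod : (fun ω => quantile μ₁ (U₁ ω) * quantile (powLaw μ₂ d) (U ω)) =ᵐ[P]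
      fun ω => quantile μ₁ (U₁ ω) * X₂ ω ^ d :=
    Filter.EventuallyEq.rfl.mul hae.symm
  exact ⟨_, X₂, (hasLaw_quantile μ₁).fun_comp hU₁, hX₂, hint.congr hprod,
    integral_congr_ae hprod⟩

theorem attains_of_comonotone (hU₁ : HasLaw U₁ unif P) (hU : HasLaw U unif P)
    (hU₂ : HasLaw U₂ unif P) (h : Comonotone P (fun ω => quantile μ₂ (U₂ ω) ^ d) U)
    (hint : Integrable (fun ω => quantile μ₁ (U₁ ω) * quantile (powLaw μ₂ d) (U ω)) P) :
    Attains P μ₁ μ₂ d U₁ U₂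
      (∫ ω, quantile μ₁ (U₁ ω) * quantile (powLaw μ₂ d) (U ω) ∂P) := by
  have hX₂ : HasLaw (fun ω => quantile μ₂ (U₂ ω)) μ₂ P := (hasLaw_quantile μ₂).fun_comp hU₂
  have hprod : (fun ω => quantile μ₁ (U₁ ω) * quantile μ₂ (U₂ ω) ^ d) =ᵐ[P]
      fun ω => quantile μ₁ (U₁ ω) * quantile (powLaw μ₂ d) (U ω) :=
    Filter.EventuallyEq.rfl.mul (h.ae_eq_quantile hU (hasLaw_pow hX₂ d))
  exact ⟨hU₁, hU₂, (hasLaw_quantile μ₁).fun_comp hU₁, hX₂, hint.congr hprod.symm,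
    integral_congr_ae hprod⟩

theorem comonotone_comp (hU : HasLaw U unif P) {α β : ℝ → ℝ} (hα : MonotoneOn α (Ioo 0 1))
    (hβ : MonotoneOn β (Ioo 0 1)) : Comonotone P (fun ω => α (U ω)) (fun ω => β (U ω)) :=
  ⟨_, ae_mem_Ioo_of_hasLaw hU, fun _ hω _ hω' hlt => hα hω hω' (hβ.reflect_lt hω hω' hlt).le⟩

theorem attains_odd (hd : Odd d) (hU₁ : HasLaw U₁ unif P) (hU : HasLaw U unif P)
    (hint : Integrable (fun ω => quantile μ₁ (U₁ ω) * quantile (powLaw μ₂ d) (U ω)) P) :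
    Attains P μ₁ μ₂ d U₁ U (∫ ω, quantile μ₁ (U₁ ω) * quantile (powLaw μ₂ d) (U ω) ∂P) :=
  attains_of_comonotone hU₁ hU hU
    (comonotone_comp (β := id) hU (hd.strictMono_pow.monotone.comp_monotoneOn
      (monotoneOn_quantile μ₂)) monotoneOn_id) hint

theorem attains_evenCaseI (hd : Even d) (h : InverseBranches μ₂ (levelI μ₂))
    (hU₁ : HasLaw U₁ unif P) (hU : HasLaw U unif P) (hV : HasLaw V unif P) (hUV : IndepFun U V P)
    (hint : Integrable (fun ω => quantile μ₁ (U₁ ω) * quantile (powLaw μ₂ d) (U ω)) P) :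
    Attains P μ₁ μ₂ d U₁ (fun ω => evenCaseI μ₂ (U ω) (V ω))
      (∫ ω, quantile μ₁ (U₁ ω) * quantile (powLaw μ₂ d) (U ω) ∂P) := by
  have := hU.isProbabilityMeasure
  simp_rw [evenCaseI_eq_branchMixture]
  exact attains_of_comonotone hU₁ hU
    ((hasLaw_branchMixture_levelI h).fun_comp (hUV.hasLaw_prod hU hV))
    (comonotone_branchMixture_levelI_pow hU h hd) hint

theorem attains_evenCaseK (hd : Even d) (h : InverseBranches μ₂ (levelK μ₂))
    (hU₁ : HasLaw U₁ unif P) (hU : HasLaw U unif P) (hV : HasLaw V unif P) (hUV : IndepFun U V P)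
    (hint : Integrable (fun ω => quantile μ₁ (U₁ ω) * quantile (powLaw μ₂ d) (U ω)) P) :
    Attains P μ₁ μ₂ d U₁ (fun ω => evenCaseK μ₂ (U ω) (V ω))
      (∫ ω, quantile μ₁ (U₁ ω) * quantile (powLaw μ₂ d) (U ω) ∂P) := by
  have := hU.isProbabilityMeasure
  simp_rw [evenCaseK_eq_branchMixture]
  exact attains_of_comonotone hU₁ hU
    ((hasLaw_branchMixture_levelK h).fun_comp (hUV.hasLaw_prod hU hV))
    (comonotone_branchMixture_levelK_pow hU h hd) hint

end Attainment

section Bounds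

variable {Ω : Type*} [MeasurableSpace Ω] {P : Measure Ω} {μ₁ μ₂ : Measure ℝ}
  [IsProbabilityMeasure μ₁] [IsProbabilityMeasure μ₂] {d : ℕ} {X₁ X₂ U : Ω → ℝ} {e : ℝ}

theorem identDistrib_quantile {μ : Measure ℝ} [IsProbabilityMeasure μ] (hX : HasLaw X₁ μ P)
    (hU : HasLaw U unif P) : IdentDistrib X₁ (fun ω => quantile μ (U ω)) P P :=
  hX.identDistrib ((hasLaw_quantile μ).fun_comp hU)

theorem comonotone_neg_quantile_one_sub (hU : HasLaw U unif P) (μ ν : Measure ℝ) :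
    Comonotone P (fun ω => -quantile μ (1 - U ω)) (fun ω => quantile ν (U ω)) := by
  refine comonotone_comp (α := fun u => -quantile μ (1 - u)) hU (fun u hu u' hu' h => ?_)
    (monotoneOn_quantile ν)
  exact neg_le_neg (monotoneOn_quantile μ (Ioo.mem_iff_one_sub_mem.1 hu')
    (Ioo.mem_iff_one_sub_mem.1 hu) (by linarith))

theorem integrable_posPart_mul_pow (hU : HasLaw U unif P)
    (hint : Integrable (fun ω => quantile μ₁ (U ω) * quantile (powLaw μ₂ d) (U ω)) P)
    (h₁ : HasLaw X₁ μ₁ P) (h₂ : HasLaw X₂ μ₂ P) :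
    Integrable (fun ω => max (X₁ ω * X₂ ω ^ d) 0) P := by
  have := hU.isProbabilityMeasure
  exact (comonotone_comp hU (monotoneOn_quantile _) (monotoneOn_quantile _)).integrable_posPart_mul
    (identDistrib_quantile h₁ hU) (identDistrib_quantile (hasLaw_pow h₂ d) hU) hint

theorem le_integral_of_mem_mixedMoments (hU : HasLaw U unif P)
    (hint : Integrable (fun ω => quantile μ₁ (U ω) * quantile (powLaw μ₂ d) (U ω)) P)
    (he : e ∈ mixedMoments P μ₁ μ₂ d) :
    e ≤ ∫ ω, quantile μ₁ (U ω) * quantile (powLaw μ₂ d) (U ω) ∂P := by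
  have := hU.isProbabilityMeasure
  obtain ⟨X₁, X₂, h₁, h₂, hX, rfl⟩ := he
  exact (comonotone_comp hU (monotoneOn_quantile _) (monotoneOn_quantile _)).integral_mul_le
    (identDistrib_quantile h₁ hU) (identDistrib_quantile (hasLaw_pow h₂ d) hU) hint hX

theorem integrable_negPart_mul_pow (hU : HasLaw U unif P)
    (hint : Integrable (fun ω => quantile μ₁ (1 - U ω) * quantile (powLaw μ₂ d) (U ω)) P)
    (h₁ : HasLaw X₁ μ₁ P) (h₂ : HasLaw X₂ μ₂ P) :
    Integrable (fun ω => max (-(X₁ ω * X₂ ω ^ d)) 0) P := by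
  have := hU.isProbabilityMeasure
  simp_rw [← neg_mul]
  exact (comonotone_neg_quantile_one_sub hU _ _).integrable_posPart_mul
    ((identDistrib_quantile h₁ (hasLaw_one_sub.fun_comp hU)).comp measurable_neg)
    (identDistrib_quantile (hasLaw_pow h₂ d) hU) (by simpa only [neg_mul] using hint.fun_neg)

theorem integral_le_of_mem_mixedMoments (hU : HasLaw U unif P)
    (hint : Integrable (fun ω => quantile μ₁ (1 - U ω) * quantile (powLaw μ₂ d) (U ω)) P)
    (he : e ∈ mixedMoments P μ₁ μ₂ d) :
    ∫ ω, quantile μ₁ (1 - U ω) * quantile (powLaw μ₂ d) (U ω) ∂P ≤ e := by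
  have := hU.isProbabilityMeasure
  obtain ⟨X₁, X₂, h₁, h₂, hX, rfl⟩ := he
  rw [← neg_le_neg_iff, ← integral_neg, ← integral_neg]
  simp_rw [← neg_mul]
  exact (comonotone_neg_quantile_one_sub hU _ _).integral_mul_le
    ((identDistrib_quantile h₁ (hasLaw_one_sub.fun_comp hU)).comp measurable_neg)
    (identDistrib_quantile (hasLaw_pow h₂ d) hU) (by simpa only [neg_mul] using hint.fun_neg)
    (by simpa only [neg_mul] using hX.fun_neg)

end Bounds

end SharpBounds

theorem theorem1_general {Ω : Type*} [MeasurableSpace Ω] (P : Measure Ω)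
    (μ₁ μ₂ : Measure ℝ) [IsProbabilityMeasure μ₁] [IsProbabilityMeasure μ₂]
    (d : ℕ) (U V : Ω → ℝ)
    (hU : HasLaw U unif P) (hV : HasLaw V unif P)
    (hUV : IndepFun U V P) :
    (∀ M : ℝ,
      Integrable (fun ω => quantile μ₁ (U ω) * quantile (powLaw μ₂ d) (U ω)) P →
      M = ∫ ω, quantile μ₁ (U ω) * quantile (powLaw μ₂ d) (U ω) ∂P →
      (∀ X₁ X₂ : Ω → ℝ, HasLaw X₁ μ₁ P → HasLaw X₂ μ₂ P →
        Integrable (fun ω => max (X₁ ω * X₂ ω ^ d) 0) P) ∧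
      IsGreatest (mixedMoments P μ₁ μ₂ d) M ∧
      (Odd d → Attains P μ₁ μ₂ d U U M) ∧
      (Even d → InverseBranches μ₂ (levelI μ₂) →
        Attains P μ₁ μ₂ d U (fun ω => evenCaseI μ₂ (U ω) (V ω)) M) ∧
      (Even d → InverseBranches μ₂ (levelK μ₂) →
        Attains P μ₁ μ₂ d U (fun ω => evenCaseK μ₂ (U ω) (V ω)) M)) ∧
    (∀ m : ℝ,
      Integrable (fun ω => quantile μ₁ (1 - U ω) * quantile (powLaw μ₂ d) (U ω)) P →
      m = ∫ ω, quantile μ₁ (1 - U ω) * quantile (powLaw μ₂ d) (U ω) ∂P →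
      (∀ X₁ X₂ : Ω → ℝ, HasLaw X₁ μ₁ P → HasLaw X₂ μ₂ P →
        Integrable (fun ω => max (-(X₁ ω * X₂ ω ^ d)) 0) P) ∧
      IsLeast (mixedMoments P μ₁ μ₂ d) m ∧
      (Odd d → Attains P μ₁ μ₂ d (fun ω => 1 - U ω) U m) ∧
      (Even d → InverseBranches μ₂ (levelI μ₂) →
        Attains P μ₁ μ₂ d (fun ω => 1 - U ω) (fun ω => evenCaseI μ₂ (U ω) (V ω)) m) ∧
      (Even d → InverseBranches μ₂ (levelK μ₂) →
        Attains P μ₁ μ₂ d (fun ω => 1 - U ω) (fun ω => evenCaseK μ₂ (U ω) (V ω)) m)) := by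
  refine ⟨?_, ?_⟩
  · rintro M hint rfl
    exact ⟨fun X₁ X₂ h₁ h₂ => integrable_posPart_mul_pow hU hint h₁ h₂,
      ⟨integral_mem_mixedMoments hU hU hV hUV hint,
        fun e he => le_integral_of_mem_mixedMoments hU hint he⟩,
      fun hd => attains_odd hd hU hU hint,
      fun hd h => attains_evenCaseI hd h hU hU hV hUV hint,
      fun hd h => attains_evenCaseK hd h hU hU hV hUV hint⟩
  · rintro m hint rfl
    have hU₁ : HasLaw (fun ω => 1 - U ω) unif P := hasLaw_one_sub.fun_comp hU
    exact ⟨fun X₁ X₂ h₁ h₂ => integrable_negPart_mul_pow hU hint h₁ h₂,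
      ⟨integral_mem_mixedMoments hU₁ hU hV hUV hint,
        fun e he => integral_le_of_mem_mixedMoments hU hint he⟩,
      fun hd => attains_odd hd hU₁ hU hint,
      fun hd h => attains_evenCaseI hd h hU₁ hU hV hUV hint,
      fun hd h => attains_evenCaseK hd h hU₁ hU hV hUV hint⟩

theorem theorem1 {Ω : Type*} [MeasurableSpace Ω] (P : Measure Ω) [IsProbabilityMeasure P]
    (μ₁ μ₂ : Measure ℝ) [IsProbabilityMeasure μ₁] [IsProbabilityMeasure μ₂]
    (d : ℕ) (hd : 0 < d) (U V : Ω → ℝ)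
    (hU : HasLaw U SharpBounds.unif P) (hV : HasLaw V SharpBounds.unif P)
    (hUV : IndepFun U V P) :
    -- the upper bound `M` and the couplings that attain it
    (∀ M : ℝ,
      Integrable (fun ω => quantile μ₁ (U ω) * quantile (powLaw μ₂ d) (U ω)) P →
      M = ∫ ω, quantile μ₁ (U ω) * quantile (powLaw μ₂ d) (U ω) ∂P →
      (∀ X₁ X₂ : Ω → ℝ, HasLaw X₁ μ₁ P → HasLaw X₂ μ₂ P →
        Integrable (fun ω => max (X₁ ω * X₂ ω ^ d) 0) P) ∧
      IsGreatest (mixedMoments P μ₁ μ₂ d) M ∧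
      (Odd d → Attains P μ₁ μ₂ d U U M) ∧
      (Even d → lowerEnd μ₂ ≤ 0 → 0 < upperEnd μ₂ → -lowerEnd μ₂ ≤ upperEnd μ₂ →
        InverseBranches μ₂ (levelI μ₂) →
        Attains P μ₁ μ₂ d U (fun ω => evenCaseI μ₂ (U ω) (V ω)) M) ∧
      (Even d → lowerEnd μ₂ < 0 → 0 ≤ upperEnd μ₂ → upperEnd μ₂ ≤ -lowerEnd μ₂ →
        InverseBranches μ₂ (levelK μ₂) →
        Attains P μ₁ μ₂ d U (fun ω => evenCaseK μ₂ (U ω) (V ω)) M)) ∧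
    -- the lower bound `m` and the couplings that attain it
    (∀ m : ℝ,
      Integrable (fun ω => quantile μ₁ (1 - U ω) * quantile (powLaw μ₂ d) (U ω)) P →
      m = ∫ ω, quantile μ₁ (1 - U ω) * quantile (powLaw μ₂ d) (U ω) ∂P →
      (∀ X₁ X₂ : Ω → ℝ, HasLaw X₁ μ₁ P → HasLaw X₂ μ₂ P →
        Integrable (fun ω => max (-(X₁ ω * X₂ ω ^ d)) 0) P) ∧
      IsLeast (mixedMoments P μ₁ μ₂ d) m ∧
      (Odd d → Attains P μ₁ μ₂ d (fun ω => 1 - U ω) U m) ∧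
      (Even d → lowerEnd μ₂ ≤ 0 → 0 < upperEnd μ₂ → -lowerEnd μ₂ ≤ upperEnd μ₂ →
        InverseBranches μ₂ (levelI μ₂) →
        Attains P μ₁ μ₂ d (fun ω => 1 - U ω) (fun ω => evenCaseI μ₂ (U ω) (V ω)) m) ∧
      (Even d → lowerEnd μ₂ < 0 → 0 ≤ upperEnd μ₂ → upperEnd μ₂ ≤ -lowerEnd μ₂ →
        InverseBranches μ₂ (levelK μ₂) →
        Attains P μ₁ μ₂ d (fun ω => 1 - U ω) (fun ω => evenCaseK μ₂ (U ω) (V ω)) m)) := by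
  obtain ⟨hupper, hlower⟩ := theorem1_general P μ₁ μ₂ d U V hU hV hUV
  refine ⟨fun M hint hM => ?_, fun m hint hm => ?_⟩
  · obtain ⟨hpos, hmax, hodd, hI, hK⟩ := hupper M hint hM
    exact ⟨hpos, hmax, hodd, fun hd _ _ _ => hI hd, fun hd _ _ _ => hK hd⟩
  · obtain ⟨hneg, hmin, hodd, hI, hK⟩ := hlower m hint hm
    exact ⟨hneg, hmin, hodd, fun hd _ _ _ => hI hd, fun hd _ _ _ => hK hd⟩
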